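/- Let $H$ be a complex Hilbert space and let $T$ be a bounded linear operator on $H$ that is normal, i.e. $TT^*=T^*T$. Suppose that $T$ is absolutely minimum attaining (an $\mathcal{AM}$-operator): for every nonzero closed subspace $M\subseteq H$ there is a unit vector $x\in M$ with $\|Tx\|=\inf\{\|Ty\| : y\in M,\ \|y\|=1\}$. Put $|T|=\sqrt{T^*T}$ and let $\Lambda=\sigma(|T|)$ be its spectrum. Then there exists a family $(H_\beta,U_\beta)_{\beta\in\Lambda}$, where each $H_\beta$ is a (possibly zero) closed subspace of $H$ that reduces $T$, i.e. $T(H_\beta)\subseteq H_\beta$ and $T(H_\beta^\perp)\subseteq H_\beta^\perp$, and each $U_\beta$ is a unitary operator on $H_\beta$, such that 1. $H=\bigoplus_{\beta\in\Lambda}H_\beta$ (orthogonal Hilbert space direct sum); 2. $T=\bigoplus_{\beta\in\Lambda}\beta U_\beta$, i.e. if $x\in H$ has components $(x_\beta)_{\beta\in\Lambda}$, then $Tx$ has components $(\beta U_\beta x_\beta)_{\beta\in\Lambda}$. -/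

import Mathlib

section AMOperators

variable {H₁ H₂ : Type*} [NormedAddCommGroup H₁] [InnerProductSpace ℂ H₁]
  [NormedAddCommGroup H₂] [InnerProductSpace ℂ H₂]

/-- The minimum modulus `m(T) = inf {‖T x‖ : ‖x‖ = 1}`. -/
noncomputable def minModulus (T : H₁ →L[ℂ] H₂) : ℝ :=
  sInf {r : ℝ | ∃ x : H₁, ‖x‖ = 1 ∧ r = ‖T x‖}

/-- `T` is minimum attaining: `‖T x‖ = m(T)` for some unit vector `x`. -/
def IsMinimumAttaining (T : H₁ →L[ℂ] H₂) : Prop :=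
  ∃ x : H₁, ‖x‖ = 1 ∧ minModulus T = ‖T x‖

/-- `T` is absolutely minimum attaining: its restriction to every closed subspace `M` is minimum
attaining. The zero subspace is left out, since it has no unit vectors. -/
def IsAbsolutelyMinimumAttaining (T : H₁ →L[ℂ] H₂) : Prop :=
  ∀ M : Submodule ℂ H₁, IsClosed (M : Set H₁) → M ≠ ⊥ → IsMinimumAttaining (T ∘L M.subtypeL)

end AMOperators

section DirectSums

variable {H : Type*} [NormedAddCommGroup H] [InnerProductSpace ℂ H]

/-- The closed subspace `M` reduces `T`: both `M` and its orthogonal complement are invariant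
under `T`. -/
def IsReducingSubspace (T : H →L[ℂ] H) (M : ClosedSubmodule ℂ H) : Prop :=
  (∀ x ∈ M.toSubmodule, T x ∈ M.toSubmodule) ∧
    ∀ x ∈ M.toSubmoduleᗮ, T x ∈ M.toSubmoduleᗮ

/-- `H` is the orthogonal (Hilbert space) direct sum of the closed subspaces `M i`. -/
def IsOrthogonalDirectSum [CompleteSpace H] {ι : Type*} (M : ι → ClosedSubmodule ℂ H) : Prop :=
  IsHilbertSum ℂ (fun i => (M i).toSubmodule) (fun i => (M i).toSubmodule.subtypeₗᵢ)

/-- `T = ⨁ S i` with respect to the orthogonal decomposition `H = ⨁ M i`: writing `x ∈ H` through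
its components `(x i)`, the components of `T x` are `(S i (x i))`. -/
def IsDirectSumOperator [CompleteSpace H] {ι : Type*} {M : ι → ClosedSubmodule ℂ H}
    (hM : IsOrthogonalDirectSum M) (T : H →L[ℂ] H)
    (S : ∀ i, (M i).toSubmodule →L[ℂ] (M i).toSubmodule) : Prop :=
  ∀ (x : H) (i : ι),
    IsHilbertSum.linearIsometryEquiv hM (T x) i =
      S i (IsHilbertSum.linearIsometryEquiv hM x i)

instance ClosedSubmodule.completeSpace_toSubmodule [CompleteSpace H] (M : ClosedSubmodule ℂ H) :
    CompleteSpace M.toSubmodule :=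
  M.isClosed.completeSpace_coe

end DirectSums

/-!
Let `N` be the orthogonal complement of the span of the eigenvectors of `T†T`. It is invariant under
`T†T`, so if it were nonzero, a unit vector at which `T` attains its minimum on `N` would minimise
the quadratic form of `T†T` restricted to `N`, and hence be an eigenvector of `T†T` in `N`. So the
eigenvectors of `T†T = |T|²` are total, and therefore so are those of `|T|`. As `T` is normal, it
commutes with `|T|`, so the eigenspaces of `|T|` reduce `T`. On the eigenspace for `β` we have
`T†T = β²`, which together with normality makes `T` a multiple `β U` of a unitary operator.
-/

open Module.End ContinuousLinearMap

lemma exists_mem_unitary_eq_smul {𝕜 A : Type*} [Field 𝕜] [StarRing 𝕜] [NormedRing A] [StarRing A]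
    [CStarRing A] [Algebra 𝕜 A] [StarModule 𝕜 A] {a : A} (ha : IsStarNormal a) {r : 𝕜}
    (h : star a * a = (star r * r) • (1 : A)) : ∃ u ∈ unitary A, a = r • u := by
  rcases eq_or_ne r 0 with rfl | hr
  · refine ⟨1, one_mem _, ?_⟩
    rw [zero_smul, ← CStarRing.star_mul_self_eq_zero_iff, h, mul_zero, zero_smul]
  · have hr' : star r ≠ 0 := star_ne_zero.2 hr
    refine ⟨r⁻¹ • a, ?_, (smul_inv_smul₀ hr a).symm⟩
    have hunit : star (r⁻¹ • a) * (r⁻¹ • a) = 1 := by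
      rw [star_smul, smul_mul_smul_comm, h, smul_smul, star_inv₀,
        mul_mul_mul_comm, inv_mul_cancel₀ hr', inv_mul_cancel₀ hr, mul_one, one_smul]
    refine Unitary.mem_iff.2 ⟨hunit, ?_⟩
    rwa [← (ha.smul r⁻¹).star_comm_self.eq]

section Eigenspaces

variable {𝕜 E : Type*} [NontriviallyNormedField 𝕜] [NormedAddCommGroup E] [NormedSpace 𝕜 E]

lemma iSup_spectrum_eigenspace [CompleteSpace E] (P : E →L[𝕜] E) :
    ⨆ β : spectrum 𝕜 P, eigenspace (P : E →ₗ[𝕜] E) β = ⨆ μ, eigenspace (P : E →ₗ[𝕜] E) μ := by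
  refine le_antisymm (iSup_le fun β => le_iSup _ (β : 𝕜)) (iSup_le fun μ => ?_)
  by_cases hμ : HasEigenvalue (P : E →ₗ[𝕜] E) μ
  · have hmem : μ ∈ spectrum 𝕜 P := by
      rw [P.spectrum_eq]
      exact hμ.mem_spectrum
    exact le_iSup (fun β : spectrum 𝕜 P => eigenspace (P : E →ₗ[𝕜] E) β) ⟨μ, hmem⟩
  · rw [hasEigenvalue_iff, not_not] at hμ
    simp only [hμ, bot_le]

/-- The eigenspace of a bounded operator, bundled as a closed subspace so that the eigenspaces of
`|T|` can serve as the summands `H_β`. Any scalar `μ` is allowed, and the eigenspace is zero when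
`μ` is not an eigenvalue. -/
def closedEigenspace (P : E →L[𝕜] E) (μ : 𝕜) : ClosedSubmodule 𝕜 E where
  toSubmodule := eigenspace (P : E →ₗ[𝕜] E) μ
  isClosed' := isClosed_eigenspace P μ

lemma mem_closedEigenspace {P : E →L[𝕜] E} {μ : 𝕜} {x : E} :
    x ∈ (closedEigenspace P μ).toSubmodule ↔ P x = μ • x :=
  mem_eigenspace_iff

lemma apply_mem_closedEigenspace_of_commute {P S : E →L[𝕜] E} (h : Commute P S) {μ : 𝕜} {x : E}
    (hx : x ∈ (closedEigenspace P μ).toSubmodule) : S x ∈ (closedEigenspace P μ).toSubmodule := by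
  rw [mem_closedEigenspace] at hx ⊢
  calc P (S x) = S (P x) := congr($(h.eq) x)
    _ = μ • S x := by rw [hx, map_smul]

end Eigenspaces

section InnerProductSpace

variable {𝕜 E : Type*} [RCLike 𝕜] [NormedAddCommGroup E] [InnerProductSpace 𝕜 E]

lemma eigenspace_mul_self_le_iSup_eigenspace {P : E →ₗ[𝕜] E} (hP : P.IsSymmetric) (ν : 𝕜) :
    eigenspace (P * P) (ν * ν) ≤ ⨆ μ, eigenspace P μ := by
  intro x hx
  rw [mem_eigenspace_iff, Module.End.mul_apply] at hx
  rcases eq_or_ne ν 0 with rfl | hν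
  · have hPx : inner 𝕜 (P x) (P x) = 0 := by rw [hP, hx, mul_zero, zero_smul, inner_zero_right]
    refine Submodule.mem_iSup_of_mem 0 ?_
    rw [mem_eigenspace_iff, inner_self_eq_zero.1 hPx, zero_smul]
  · have hplus : P x + ν • x ∈ eigenspace P ν := by
      rw [mem_eigenspace_iff, map_add, map_smul, hx]
      module
    have hminus : P x - ν • x ∈ eigenspace P (-ν) := by
      rw [mem_eigenspace_iff, map_sub, map_smul, hx]
      module
    have hsplit : x = (2 * ν)⁻¹ • ((P x + ν • x) - (P x - ν • x)) := by
      match_scalars <;> field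
    rw [hsplit]
    exact Submodule.smul_mem _ _ <|
      sub_mem (Submodule.mem_iSup_of_mem ν hplus) (Submodule.mem_iSup_of_mem (-ν) hminus)

variable [CompleteSpace E] {F : Type*} [NormedAddCommGroup F] [InnerProductSpace 𝕜 F]
  [CompleteSpace F] {K : Submodule 𝕜 E} [CompleteSpace K]

lemma adjoint_restrict {L : Submodule 𝕜 F} [CompleteSpace L] {T : E →L[𝕜] F}
    (hT : ∀ x ∈ K, T x ∈ L) (hT' : ∀ y ∈ L, adjoint T y ∈ K) :
    adjoint (T.restrict hT) = (adjoint T).restrict hT' := by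
  rw [eq_comm, eq_adjoint_iff]
  exact fun y x => adjoint_inner_left T (x : E) (y : F)

lemma adjoint_comp_self_comp_subtypeL {T : E →L[𝕜] F}
    (hK : ∀ x ∈ K, (adjoint T ∘L T) x ∈ K) :
    adjoint (T ∘L K.subtypeL) ∘L (T ∘L K.subtypeL) = (adjoint T ∘L T).restrict hK := by
  refine ContinuousLinearMap.ext fun x => ext_inner_left 𝕜 fun v => ?_
  rw [comp_apply, adjoint_inner_right]
  exact (adjoint_inner_right T (v : E) (T x)).symm

end InnerProductSpace

section MinimumAttaining

variable {H₁ H₂ : Type*} [NormedAddCommGroup H₁] [InnerProductSpace ℂ H₁]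
  [NormedAddCommGroup H₂] [InnerProductSpace ℂ H₂]

lemma minModulus_le_norm_apply {T : H₁ →L[ℂ] H₂} {y : H₁} (hy : ‖y‖ = 1) : minModulus T ≤ ‖T y‖ :=
  csInf_le ⟨0, by rintro _ ⟨z, -, rfl⟩; exact norm_nonneg _⟩ ⟨y, hy, rfl⟩

variable [CompleteSpace H₁] [CompleteSpace H₂]

lemma IsMinimumAttaining.hasEigenvalue_adjoint_comp_self {T : H₁ →L[ℂ] H₂}
    (hT : IsMinimumAttaining T) :
    HasEigenvalue (adjoint T ∘L T : H₁ →ₗ[ℂ] H₁) ((minModulus T ^ 2 : ℝ) : ℂ) := by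
  obtain ⟨x, hx, hmin⟩ := hT
  have hself : IsSelfAdjoint (adjoint T ∘L T) := (isPositive_adjoint_comp_self T).isSelfAdjoint
  have hquad (y : H₁) : (adjoint T ∘L T).reApplyInnerSelf y = ‖T y‖ ^ 2 := by
    rw [reApplyInnerSelf_apply, ← apply_norm_sq_eq_inner_adjoint_left]
  have hextr : IsMinOn (adjoint T ∘L T).reApplyInnerSelf (Metric.sphere 0 ‖x‖) x := by
    intro y hy
    rw [hx, mem_sphere_zero_iff_norm] at hy
    simp only [Set.mem_ofPred_eq, hquad, ← hmin]
    have hnonneg : 0 ≤ minModulus T := hmin ▸ norm_nonneg _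
    gcongr
    exact minModulus_le_norm_apply hy
  have hx0 : x ≠ 0 := norm_ne_zero_iff.1 (hx ▸ one_ne_zero)
  have heig := hself.hasEigenvector_of_isLocalExtrOn hx0 (.inl hextr.localize)
  rw [rayleighQuotient, hquad, hx, one_pow, div_one, ← hmin] at heig
  exact hasEigenvalue_of_hasEigenvector heig

lemma IsAbsolutelyMinimumAttaining.orthogonal_iSup_eigenspace_adjoint_comp_self
    {T : H₁ →L[ℂ] H₂} (hT : IsAbsolutelyMinimumAttaining T) :
    (⨆ μ, eigenspace (adjoint T ∘L T : H₁ →ₗ[ℂ] H₁) μ)ᗮ = ⊥ := by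
  have hsymm := (isPositive_adjoint_comp_self T).isSymmetric
  have hinv := hsymm.orthogonalComplement_iSup_eigenspaces_invariant
  by_contra hne
  have heig := (hT _ (Submodule.isClosed_orthogonal _) hne).hasEigenvalue_adjoint_comp_self
  rw [adjoint_comp_self_comp_subtypeL hinv] at heig
  exact heig (hsymm.orthogonalComplement_iSup_eigenspaces _)

lemma IsAbsolutelyMinimumAttaining.orthogonal_iSup_eigenspace_abs {T : H₁ →L[ℂ] H₁}
    (hT : IsAbsolutelyMinimumAttaining T) :
    (⨆ μ, eigenspace (CFC.abs T).toLinearMap μ)ᗮ = ⊥ := by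
  have hsymm := ((nonneg_iff_isPositive _).1 (CFC.abs_nonneg T)).isSymmetric
  have hsq : (adjoint T ∘L T : H₁ →ₗ[ℂ] H₁) =
      (CFC.abs T).toLinearMap * (CFC.abs T).toLinearMap :=
    congrArg toLinearMap (CFC.abs_mul_abs T).symm
  rw [eq_bot_iff, ← hT.orthogonal_iSup_eigenspace_adjoint_comp_self, hsq]
  refine Submodule.orthogonal_le (iSup_le fun μ => ?_)
  obtain ⟨ν, rfl⟩ := IsAlgClosed.exists_eq_mul_self μ
  exact eigenspace_mul_self_le_iSup_eigenspace hsymm ν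

end MinimumAttaining

section ReducingSubspaces

variable {H : Type*} [NormedAddCommGroup H] [InnerProductSpace ℂ H] [CompleteSpace H]

lemma isReducingSubspace_iff_adjoint {T : H →L[ℂ] H} {M : ClosedSubmodule ℂ H} :
    IsReducingSubspace T M ↔
      (∀ x ∈ M.toSubmodule, T x ∈ M.toSubmodule) ∧
        ∀ x ∈ M.toSubmodule, adjoint T x ∈ M.toSubmodule :=
  and_congr_right fun _ => (mem_invtSubmodule_adjoint_iff (T := T) (U := M.toSubmodule)).symm

lemma isReducingSubspace_closedEigenspace {P T : H →L[ℂ] H} (hP : IsSelfAdjoint P)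
    (hPT : Commute P T) (μ : ℂ) : IsReducingSubspace T (closedEigenspace P μ) := by
  have hPT' : Commute P (adjoint T) := by
    simpa only [hP.star_eq, star_eq_adjoint] using hPT.star_star
  exact isReducingSubspace_iff_adjoint.2
    ⟨fun _ => apply_mem_closedEigenspace_of_commute hPT,
      fun _ => apply_mem_closedEigenspace_of_commute hPT'⟩

lemma isReducingSubspace_closedEigenspace_abs {T : H →L[ℂ] H} (hT : IsStarNormal T) (μ : ℂ) :
    IsReducingSubspace T (closedEigenspace (CFC.abs T) μ) :=
  isReducingSubspace_closedEigenspace (CFC.abs_nonneg T).isSelfAdjoint (CFC.commute_abs_self T) μ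

lemma IsReducingSubspace.exists_unitary_restrict_eq_smul {T : H →L[ℂ] H} (hT : IsStarNormal T)
    {M : ClosedSubmodule ℂ H} (hM : IsReducingSubspace T M) {β : ℂ}
    (hβ : ∀ x ∈ M.toSubmodule, adjoint T (T x) = (star β * β) • x) :
    ∃ U ∈ unitary (M.toSubmodule →L[ℂ] M.toSubmodule), T.restrict hM.1 = β • U := by
  have hadj := adjoint_restrict hM.1 (isReducingSubspace_iff_adjoint.1 hM).2
  have hnormal : IsStarNormal (T.restrict hM.1) := by
    rw [isStarNormal_iff, star_eq_adjoint, hadj]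
    ext x
    exact congr($(hT.star_comm_self.eq) x)
  refine exists_mem_unitary_eq_smul (A := M.toSubmodule →L[ℂ] M.toSubmodule) hnormal ?_
  rw [star_eq_adjoint, hadj]
  ext x
  exact hβ x x.2

lemma inner_linearIsometryEquiv_apply {ι : Type*} {M : ι → ClosedSubmodule ℂ H}
    (hM : IsOrthogonalDirectSum M) (x : H) (i : ι) (v : (M i).toSubmodule) :
    inner ℂ v (IsHilbertSum.linearIsometryEquiv hM x i) = inner ℂ (v : H) x := by
  classical
  calc inner ℂ v (IsHilbertSum.linearIsometryEquiv hM x i)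
      = inner ℂ (lp.single 2 i v) (IsHilbertSum.linearIsometryEquiv hM x) :=
        (lp.inner_single_left (𝕜 := ℂ) (G := fun i => (M i).toSubmodule) i v _).symm
    _ = inner ℂ (v : H) x := by
        rw [← (IsHilbertSum.linearIsometryEquiv hM).symm.inner_map_map,
          IsHilbertSum.linearIsometryEquiv_symm_apply_single hM v,
          LinearIsometryEquiv.symm_apply_apply, Submodule.coe_subtypeₗᵢ,
          Submodule.subtype_apply]

lemma isDirectSumOperator_restrict {ι : Type*} {M : ι → ClosedSubmodule ℂ H}
    (hM : IsOrthogonalDirectSum M) {T : H →L[ℂ] H} (hT : ∀ i, IsReducingSubspace T (M i)) :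
    IsDirectSumOperator hM T fun i => T.restrict (hT i).1 := by
  intro x i
  refine ext_inner_left ℂ fun v => ?_
  have hv : adjoint T v ∈ (M i).toSubmodule := (isReducingSubspace_iff_adjoint.1 (hT i)).2 v v.2
  rw [inner_linearIsometryEquiv_apply, Submodule.coe_inner, coe_restrict_apply,
    ← adjoint_inner_left, ← adjoint_inner_left]
  exact (inner_linearIsometryEquiv_apply hM x i ⟨adjoint T v, hv⟩).symm

lemma isOrthogonalDirectSum_closedEigenspace {P : H →L[ℂ] H} (hP : IsSelfAdjoint P)
    (htotal : (⨆ μ, eigenspace (P : H →ₗ[ℂ] H) μ)ᗮ = ⊥) :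
    IsOrthogonalDirectSum fun β : spectrum ℂ P => closedEigenspace P (β : ℂ) := by
  refine IsHilbertSum.mkInternal _
    (hP.isSymmetric.orthogonalFamily_eigenspaces.comp Subtype.coe_injective) ?_
  rw [← iSup_spectrum_eigenspace] at htotal
  exact (Submodule.topologicalClosure_eq_top_iff.2 htotal).ge

lemma exists_unitary_restrict_closedEigenspace_abs {T : H →L[ℂ] H} (hT : IsStarNormal T)
    (β : spectrum ℂ (CFC.abs T)) :
    ∃ U ∈ unitary ((closedEigenspace (CFC.abs T) (β : ℂ)).toSubmodule →L[ℂ]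
      (closedEigenspace (CFC.abs T) (β : ℂ)).toSubmodule),
      T.restrict (isReducingSubspace_closedEigenspace_abs hT β).1 = (β : ℂ) • U := by
  have hβ : star (β : ℂ) = β :=
    Complex.conj_eq_iff_re.2 ((CFC.abs_nonneg T).isSelfAdjoint.mem_spectrum_eq_re β.2).symm
  refine (isReducingSubspace_closedEigenspace_abs hT β).exists_unitary_restrict_eq_smul hT
    fun x hx => ?_
  rw [mem_closedEigenspace] at hx
  calc adjoint T (T x) = CFC.abs T (CFC.abs T x) := congr($((CFC.abs_mul_abs T).symm) x)
    _ = (star (β : ℂ) * β) • x := by rw [hx, map_smul, hx, smul_smul, hβ]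

end ReducingSubspaces

theorem theorem4p9 {H : Type*} [NormedAddCommGroup H] [InnerProductSpace ℂ H] [CompleteSpace H]
    (T : H →L[ℂ] H) (hnormal : IsStarNormal T) (hAM : IsAbsolutelyMinimumAttaining T) :
    ∃ (M : spectrum ℂ (CFC.abs T) → ClosedSubmodule ℂ H)
      (U : ∀ β, (M β).toSubmodule →L[ℂ] (M β).toSubmodule),
      (∀ β, IsReducingSubspace T (M β)) ∧
      (∀ β, U β ∈ unitary ((M β).toSubmodule →L[ℂ] (M β).toSubmodule)) ∧
      ∃ hM : IsOrthogonalDirectSum M,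
        IsDirectSumOperator hM T (fun β => (β : ℂ) • U β) := by
  have hsa : IsSelfAdjoint (CFC.abs T) := (CFC.abs_nonneg T).isSelfAdjoint
  have hred (β : spectrum ℂ (CFC.abs T)) := isReducingSubspace_closedEigenspace_abs hnormal β
  have hsum := isOrthogonalDirectSum_closedEigenspace hsa hAM.orthogonal_iSup_eigenspace_abs
  choose U hU hTU using exists_unitary_restrict_closedEigenspace_abs hnormal
  refine ⟨fun β => closedEigenspace (CFC.abs T) (β : ℂ), U, hred, hU, hsum, ?_⟩
  simpa only [hTU] using isDirectSumOperator_restrict hsum hred
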